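/- Let $q=2^m$ with $m\ge 1$, let $k\ge 0$ be an integer, $d=\gcd(k,m)$ and $\sigma=2^k$. Two maps $F,G\colon \mathbb F_q^3\to\mathbb F_q^3$ are called linearly equivalent if $L_1\circ F\circ L_2=G$ for some invertible $\mathbb F_2$-linear maps $L_1,L_2$ of $\mathbb F_q^3$. The differential uniformity of $F$ is $\max_{u\neq 0,\,v}\#\{w\in\mathbb F_q^3: F(w+u)-F(w)=v\}$. For $a,b,c\in\mathbb F_q$ let $$G_{\sigma,a,b,c}(x,y,z)=\bigl(x^{\sigma+1}+ay^{\sigma}z+bx^{\sigma}y+cx^{\sigma}z,\; ay^{\sigma+1}+z^{\sigma}x+bz^{\sigma}y+cx^{\sigma}y,\; z^{\sigma+1}+x^{\sigma}y\bigr),$$ and let $\mathcal G_{a,b,c}$ (for $a\ne 0$) be the family of all maps $G_{2^{j},a,b,c}$ with $1\le j<m$ such that, with $\tau=2^j$, the equation $ax^{\tau^2+\tau+1}+bx^{\tau+1}+cx+1=0$ has no solution $x\in\mathbb F_q$. The first family of Li and Kaleyski consists of the maps $$F_\sigma(x,y,z)=(x^{\sigma+1}+x^{\sigma}z+yz^{\sigma},\;x^{\sigma}z+y^{\sigma+1},\;xy^{\sigma}+y^{\sigma}z+z^{\sigma+1})$$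 for which the following conditions (LK) hold: the polynomials $X^{\sigma^2+\sigma+1}+X+1$, $X^{\sigma^2+\sigma+1}+X^{\sigma^2}+1$ and $X^{\sigma^2+\sigma+1}+X^{\sigma^2+1}+X^{\sigma+1}+X+1$ have no roots in $\mathbb F_q$, and $X^{\sigma^2+\sigma+1}+XY^{\sigma^2+\sigma}+XY^{\sigma}+X^{\sigma^2+\sigma}+X^{\sigma}Y^{\sigma^2}+X^{\sigma^2}Y+Y^{\sigma^2+\sigma+1}+Y^{\sigma^2+\sigma}+Y^{\sigma^2}+Y^{\sigma}+1$ has no zero in $\mathbb F_q^2$. Consider the single condition (S): $X^{\sigma^2+\sigma+1}+X^{\sigma^2}+1$ has no root in $\mathbb F_q$. Then: 1. $F_\sigma$ is linearly equivalent to $G_{\sigma,1,1,0}$. 2. (LK) implies (S). 3. If (S) holds and $m\nmid k$ (that is, $x\mapsto x^\sigma$ is not the identity on $\mathbb F_q$), then $F_\sigma$ is linearly equivalent to a member of the family $\mathcal G_{1,1,0}$. In particular this applies to every function of Li and Kaleyski's first family with $m\nmid k$. 4. If (S) holds, then the differential uniformity of $F_\sigma$ is $2^d$. -/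

import Mathlib

namespace Triprojective

open Classical in
/-- The entry `#{x | F (x + u) - F x = v}` of the difference distribution table of `F`. -/
noncomputable def ddt {V : Type*} [AddCommGroup V] [Fintype V] (F : V → V) (u v : V) : ℕ :=
  (Finset.univ.filter fun x : V => F (x + u) - F x = v).card

open Classical in
/-- The differential uniformity of `F`: the maximum of `ddt F u v` over all `u ≠ 0` and all `v`. -/
noncomputable def differentialUniformity {V : Type*} [AddCommGroup V] [Fintype V]
    (F : V → V) : ℕ :=
  (Finset.univ.filter fun w : V × V => w.1 ≠ 0).sup fun w => ddt F w.1 w.2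

/-- Linear equivalence over the prime field `𝔽₂`: `L₁ ∘ F ∘ L₂ = G` with `L₁`, `L₂` invertible
`𝔽₂`-linear maps. -/
def LinearlyEquivalent {V : Type*} [AddCommGroup V] [Module (ZMod 2) V] (F G : V → V) : Prop :=
  ∃ L₁ L₂ : V ≃ₗ[ZMod 2] V, ⇑L₁ ∘ F ∘ ⇑L₂ = G

section Families

variable {K : Type*} [Field K]

/-- The trivariate map with parameters `a b c` and exponent `s` (in characteristic two). -/
def mainMap (s : ℕ) (a b c : K) : K × K × K → K × K × K := fun (x, y, z) =>
  (x ^ (s + 1) + a * y ^ s * z + b * x ^ s * y + c * x ^ s * z,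
    a * y ^ (s + 1) + z ^ s * x + b * z ^ s * y + c * x ^ s * y,
    z ^ (s + 1) + x ^ s * y)

/-- The condition that `a X^(s²+s+1) + b X^(s+1) + c X + 1` has no root in the field. -/
def MainCondition (s : ℕ) (a b c : K) : Prop :=
  ∀ x : K, a * x ^ (s ^ 2 + s + 1) + b * x ^ (s + 1) + c * x + 1 ≠ 0

/-- The family of maps `mainMap (2 ^ k) a b c` over the field with `2 ^ m` elements, for fixed
`a`, `b`, `c`: one takes `1 ≤ k < m`, requires `a ≠ 0`, and imposes the no-root condition. -/
def mainFamily (m : ℕ) (a b c : K) : Set (K × K × K → K × K × K) :=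
  {F | ∃ k : ℕ, 1 ≤ k ∧ k < m ∧ a ≠ 0 ∧ MainCondition (2 ^ k) a b c ∧ F = mainMap (2 ^ k) a b c}

variable (K) in
/-- The trivariate map of the first family of Li and Kaleyski, with exponent `s`. -/
def liKaleyskiMap (s : ℕ) : K × K × K → K × K × K := fun (x, y, z) =>
  (x ^ (s + 1) + x ^ s * z + y * z ^ s,
    x ^ s * z + y ^ (s + 1),
    x * y ^ s + y ^ s * z + z ^ (s + 1))

variable (K) in
/-- The single condition: `X^(s²+s+1) + X^(s²) + 1` has no root in `K`. -/
def SingleCondition (s : ℕ) : Prop :=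
  ∀ x : K, x ^ (s ^ 2 + s + 1) + x ^ (s ^ 2) + 1 ≠ 0

variable (K) in
/-- The four conditions that Li and Kaleyski impose on their first family. -/
def LiKaleyskiConditions (s : ℕ) : Prop :=
  (∀ x : K, x ^ (s ^ 2 + s + 1) + x + 1 ≠ 0) ∧
  (∀ x : K, x ^ (s ^ 2 + s + 1) + x ^ (s ^ 2) + 1 ≠ 0) ∧
  (∀ x : K, x ^ (s ^ 2 + s + 1) + x ^ (s ^ 2 + 1) + x ^ (s + 1) + x + 1 ≠ 0) ∧
  (∀ x y : K, x ^ (s ^ 2 + s + 1) + x * y ^ (s ^ 2 + s) + x * y ^ s + x ^ (s ^ 2 + s)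
    + x ^ s * y ^ (s ^ 2) + x ^ (s ^ 2) * y + y ^ (s ^ 2 + s + 1) + y ^ (s ^ 2 + s)
    + y ^ (s ^ 2) + y ^ s + 1 ≠ 0)

end Families

end Triprojective

/-!
The maps are diagonals `F u = B u u` of forms `B` that are semilinear along `σ : x ↦ x ^ s` in the
first and linear in the second argument, so `F (w + u) - F w = v` is an affine equation in `w` and
the differential uniformity is read off the kernels of `w ↦ B u w + B w u`.

If `w` lies in the kernel of `u ≠ 0`, then a fixed linear image `n` of `v = u × w` is orthogonal to
both `σ u` and `σ w`, hence parallel to `σ v`. A solution `v ≠ 0` of this eigenvector problem gives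
a root of the polynomial adjoint to that of `MainCondition`, and invariance of the trace under `σ`
turns such a root into a root of the polynomial itself. So `v = 0`, that is `w = t • u`, and then
`B u w + B w u = (t + σ t) • F u` with `F u ≠ 0`, which forces `σ t = t`.

The map of Li and Kaleyski is the case `a = b = 1`, `c = 0` with the last two coordinates swapped,
and `x ↦ x⁻¹` exchanges `SingleCondition` with the corresponding `MainCondition`.
-/

namespace Triprojective

section DifferentialUniformity

variable {V : Type*} [AddCommGroup V] [Fintype V] {F : V → V}

theorem ddt_eq_ncard (F : V → V) (u v : V) : ddt F u v = {x | F (x + u) - F x = v}.ncard := by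
  classical
  rw [ddt, ← Set.ncard_coe_finset, Finset.coe_filter_univ]

theorem differentialUniformity_le_iff {n : ℕ} :
    differentialUniformity F ≤ n ↔ ∀ u ≠ 0, ∀ v, ddt F u v ≤ n := by
  simp only [differentialUniformity, Finset.sup_le_iff, Finset.mem_filter, Finset.mem_univ,
    true_and, Prod.forall]
  exact forall_congr' fun u => forall_comm

theorem ddt_comp (F : V → V) (L₁ L₂ : V ≃+ V) (u v : V) :
    ddt (L₁ ∘ F ∘ L₂) u v = ddt F (L₂ u) (L₁.symm v) := by
  have hpre : {x | (L₁ ∘ F ∘ L₂) (x + u) - (L₁ ∘ F ∘ L₂) x = v} =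
      L₂ ⁻¹' {y | F (y + L₂ u) - F y = L₁.symm v} := by
    ext x
    simp only [Function.comp_apply, map_add, Set.mem_ofPred_eq, Set.preimage_ofPred_eq,
      L₁.eq_symm_apply, map_sub]
  rw [ddt_eq_ncard, ddt_eq_ncard, hpre,
    Set.ncard_preimage_of_injective_subset_range L₂.injective (by simp [L₂.surjective.range_eq])]

theorem LinearlyEquivalent.differentialUniformity_eq [Module (ZMod 2) V] {G : V → V}
    (h : LinearlyEquivalent F G) : differentialUniformity F = differentialUniformity G := by
  obtain ⟨L₁, L₂, rfl⟩ := h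
  refine eq_of_forall_ge_iff fun n => ?_
  have hddt (u v : V) : ddt (L₁ ∘ F ∘ L₂) u v = ddt F (L₂ u) (L₁.symm v) :=
    ddt_comp F L₁.toAddEquiv L₂.toAddEquiv u v
  simp only [differentialUniformity_le_iff, hddt]
  rw [L₂.surjective.forall]
  refine forall_congr' fun u => ?_
  rw [ne_eq, ne_eq, L₂.map_eq_zero_iff, L₁.symm.surjective.forall]

open QuadraticMap (polar)

theorem ddt_eq_ncard_polar (hF : ∀ u w w', polar F u (w + w') = polar F u w + polar F u w')
    (u x : V) : ddt F u (F (x + u) - F x) = {w | polar F u w = 0}.ncard := by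
  rw [ddt_eq_ncard, ← Set.ncard_image_of_injective {w | polar F u w = 0} (add_right_injective x)]
  congr 1
  ext y
  obtain ⟨w, rfl⟩ : ∃ w, y = x + w := ⟨y - x, by abel⟩
  have hdiff (y : V) : F (y + u) - F y = polar F u y + F u := by
    rw [QuadraticMap.polar, add_comm u y]; abel
  rw [Set.mem_ofPred_eq, hdiff, hdiff, hF, add_left_inj, add_eq_left]
  exact ((add_right_injective x).mem_set_image (s := {w | polar F u w = 0})).symm

theorem differentialUniformity_eq_of_ncard_polar [Nontrivial V] {n : ℕ}
    (hF : ∀ u w w', polar F u (w + w') = polar F u w + polar F u w')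
    (hn : ∀ u ≠ 0, {w | polar F u w = 0}.ncard = n) : differentialUniformity F = n := by
  refine eq_of_forall_ge_iff fun l => differentialUniformity_le_iff.trans ⟨fun h => ?_, ?_⟩
  · obtain ⟨u, hu⟩ := exists_ne (0 : V)
    rw [← hn u hu, ← ddt_eq_ncard_polar hF u 0]
    exact h u hu _
  · intro hl u hu v
    by_cases hv : ∃ x, F (x + u) - F x = v
    · obtain ⟨x, rfl⟩ := hv
      rwa [ddt_eq_ncard_polar hF, hn u hu]
    · push Not at hv
      simp [ddt_eq_ncard, hv]

end DifferentialUniformity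

section FiniteField

variable {K : Type*} [Field K]

theorem ncard_pow_succ_eq_self [Finite K] (n : ℕ) :
    {x : K | x ^ (n + 1) = x}.ncard = (Nat.card K - 1).gcd n + 1 := by
  have hset : {x : K | x ^ (n + 1) = x} =
      insert 0 (Units.val '' ((powMonoidHom n : Kˣ →* Kˣ).ker : Set Kˣ)) := by
    ext x
    rcases eq_or_ne x 0 with rfl | hx
    · simp
    · lift x to Kˣ using hx.isUnit
      simp [pow_succ, Units.val_inj, MonoidHom.mem_ker, ← Units.val_pow_eq_pow_val]
  rw [hset, Set.ncard_insert_of_notMem (by simp),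
    Set.ncard_image_of_injective _ Units.val_injective, ← Nat.card_coe_set_eq]
  congr 1
  exact (IsCyclic.card_powMonoidHom_ker Kˣ n).trans (by rw [Nat.card_units])

variable [Fintype K] {p m : ℕ}

theorem ncard_pow_pow_eq_self (hK : Fintype.card K = p ^ m) (hp : 0 < p) (k : ℕ) :
    {x : K | x ^ p ^ k = x}.ncard = p ^ k.gcd m := by
  obtain ⟨n, hn⟩ : ∃ n, p ^ k = n + 1 := Nat.exists_eq_succ_of_ne_zero (pow_pos hp k).ne'
  rw [hn, ncard_pow_succ_eq_self, Nat.card_eq_fintype_card, hK, ← Nat.add_sub_cancel n 1, ← hn,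
    Nat.pow_sub_one_gcd_pow_sub_one, Nat.gcd_comm, Nat.sub_add_cancel (pow_pos hp _)]

theorem pow_pow_mod (hK : Fintype.card K = p ^ m) (k : ℕ) (x : K) :
    x ^ p ^ (k % m) = x ^ p ^ k := by
  conv_rhs => rw [← Nat.mod_add_div k m, pow_add, pow_mul, pow_mul p m, ← hK]
  exact (FiniteField.pow_card_pow _ _).symm

end FiniteField

section TwistedPolynomial

variable {F K : Type*} [Field F] [Field K] [Algebra F K]

/-- The condition `MainCondition s a b c` with a field endomorphism `σ` in place of the power map
`x ↦ x ^ s`. -/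
def NoTwistedRoot (σ : K →+* K) (a b c : K) : Prop :=
  ∀ x : K, a * (x * σ x * σ (σ x)) + b * (x * σ x) + c * x + 1 ≠ 0

theorem MainCondition.noTwistedRoot {σ : K →+* K} {s : ℕ} (hσ : ∀ x, σ x = x ^ s) {a b c : K}
    (h : MainCondition s a b c) : NoTwistedRoot σ a b c := by
  intro x hx
  refine h x ?_
  rw [← hx, hσ, hσ]
  ring

variable [FiniteDimensional F K] [Algebra.IsSeparable F K]

theorem exists_ne_zero_of_trace_comp_eq_zero {L : K →ₗ[F] K}
    (hL : ∀ y, Algebra.trace F K (L y) = 0) : ∃ y ≠ 0, L y = 0 := by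
  by_contra! hker
  have hinj : Function.Injective L :=
    (injective_iff_map_eq_zero L).2 fun y hy => by_contra fun hy0 => hker y hy0 hy
  refine Algebra.trace_ne_zero F K (LinearMap.ext fun z => ?_)
  obtain ⟨y, rfl⟩ := LinearMap.surjective_of_injective hinj z
  exact hL y

theorem exists_twisted_root_of_adjoint_root (σ : K ≃ₐ[F] K) {a b c t : K}
    (ht : a * (t * σ t * σ (σ t)) + σ b * (σ t * σ (σ t)) + σ (σ c) * σ (σ t) + 1 = 0) :
    ∃ x, a * (x * σ x * σ (σ x)) + b * (x * σ x) + c * x + 1 = 0 := by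
  -- `x = t * σ y / y` is a root as soon as `L y = 0` and `y ≠ 0`.
  let L : K →ₗ[F] K :=
    LinearMap.mulLeft F (a * (t * σ t * σ (σ t))) ∘ₗ (σ ^ 3).toLinearMap +
      LinearMap.mulLeft F (b * (t * σ t)) ∘ₗ (σ ^ 2).toLinearMap +
      LinearMap.mulLeft F (c * t) ∘ₗ σ.toLinearMap + LinearMap.id
  have hL (y : K) : L y = a * (t * σ t * σ (σ t)) * σ (σ (σ y)) + b * (t * σ t) * σ (σ y) +
      c * t * σ y + y := rfl
  -- The assumption on `t` says that the adjoint of `L` for the trace form annihilates `1`.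
  have hσ (z : K) : Algebra.trace F K z = Algebra.trace F K (σ z) :=
    (Algebra.trace_eq_of_algEquiv σ z).symm
  have htrace (y : K) : Algebra.trace F K (L y) = 0 := by
    calc Algebra.trace F K (L y)
        = Algebra.trace F K (a * (t * σ t * σ (σ t)) * σ (σ (σ y))) +
            Algebra.trace F K (σ (b * (t * σ t) * σ (σ y))) +
            Algebra.trace F K (σ (σ (c * t * σ y))) + Algebra.trace F K (σ (σ (σ y))) := by
          rw [hL, map_add, map_add, map_add, ← hσ, ← hσ, ← hσ, ← hσ, ← hσ, ← hσ]
      _ = Algebra.trace F K (σ (σ (σ y)) * (a * (t * σ t * σ (σ t)) +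
            σ b * (σ t * σ (σ t)) + σ (σ c) * σ (σ t) + 1)) := by
          simp only [← map_add, map_mul]
          congr 1
          ring
      _ = 0 := by rw [ht, mul_zero, map_zero]
  obtain ⟨y, hy0, hy⟩ := exists_ne_zero_of_trace_comp_eq_zero htrace
  have hy1 : σ y ≠ 0 := by simpa using hy0
  have hy2 : σ (σ y) ≠ 0 := by simpa using hy0
  refine ⟨t * σ y / y, ?_⟩
  rw [hL] at hy
  simp only [map_div₀, map_mul]
  field_simp
  linear_combination hy

end TwistedPolynomial

section MainForm

variable {K : Type*} [Field K]

/-- The form with `mainForm σ a b c u u = mainMap s a b c u` when `σ` is the power map `x ↦ x ^ s`: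
in each monomial the factor with exponent `s` is taken from the first argument and the linear
factor from the second. -/
def mainForm (σ : K →+* K) (a b c : K) : K × K × K →ₛₗ[σ] K × K × K →ₗ[K] K × K × K :=
  LinearMap.mk₂'ₛₗ σ (RingHom.id K)
    (fun u w =>
      (σ u.1 * w.1 + a * σ u.2.1 * w.2.2 + b * σ u.1 * w.2.1 + c * σ u.1 * w.2.2,
        a * σ u.2.1 * w.2.1 + σ u.2.2 * w.1 + b * σ u.2.2 * w.2.1 + c * σ u.1 * w.2.1,
        σ u.2.2 * w.2.2 + σ u.1 * w.2.1))
    (fun _ _ _ => by ext <;> simp <;> ring)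
    (fun _ _ _ => by ext <;> simp <;> ring)
    (fun _ _ _ => by ext <;> simp <;> ring)
    (fun _ _ _ => by ext <;> simp <;> ring)

theorem mainForm_apply (σ : K →+* K) (a b c x y z x' y' z' : K) :
    mainForm σ a b c (x, y, z) (x', y', z') =
      (σ x * x' + a * σ y * z' + b * σ x * y' + c * σ x * z',
        a * σ y * y' + σ z * x' + b * σ z * y' + c * σ x * y',
        σ z * z' + σ x * y') :=
  rfl

theorem mainMap_eq_mainForm {σ : K →+* K} {s : ℕ} (hσ : ∀ x, σ x = x ^ s) (a b c : K)
    (u : K × K × K) : mainMap s a b c u = mainForm σ a b c u u := by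
  obtain ⟨x, y, z⟩ := u
  simp only [mainMap, mainForm_apply, hσ, pow_succ, mul_assoc]

theorem polar_mainMap {σ : K →+* K} {s : ℕ} (hσ : ∀ x, σ x = x ^ s) (a b c : K)
    (u w : K × K × K) :
    QuadraticMap.polar (mainMap s a b c) u w = mainForm σ a b c u w + mainForm σ a b c w u := by
  simp only [QuadraticMap.polar, mainMap_eq_mainForm hσ, map_add, LinearMap.add_apply]
  abel

theorem eq_zero_of_mainForm_self_eq_zero [CharP K 2] {σ : K →+* K} {a b c : K} (ha : a ≠ 0)
    (h : NoTwistedRoot σ a b c) {u : K × K × K} (hu : mainForm σ a b c u u = 0) : u = 0 := by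
  obtain ⟨x, y, z⟩ := u
  simp only [mainForm_apply, Prod.mk_eq_zero] at hu ⊢
  obtain ⟨h1, h2, h3⟩ := hu
  rcases eq_or_ne z 0 with rfl | hz
  · have hxy : σ x * y = 0 := by simpa using h3
    have hy : y = 0 := by simpa [ha, mul_assoc, hxy] using h2
    exact ⟨by simpa [hy] using h1, hy, rfl⟩
  · have hσz : σ z ≠ 0 := by simpa using hz
    have hx : x ≠ 0 := by
      rintro rfl
      simp [hz] at h3
    have hσx : σ x ≠ 0 := by simpa using hx
    have hσσx : σ (σ x) ≠ 0 := by simpa using hx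
    have h3' : σ (σ z) * σ z + σ (σ x) * σ y = 0 := by simpa using congrArg σ h3
    refine absurd ?_ (h (z / x))
    simp only [map_div₀]
    field_simp
    refine mul_left_cancel₀ hσz ?_
    linear_combination σ x * σ (σ x) * h2 - a * σ x * y * h3' +
      (a * σ (σ z) * σ z - b * σ z * σ (σ x) - c * σ x * σ (σ x)) * h3 +
      (b * σ z ^ 2 * z * σ (σ x) + c * σ z * z * σ x * σ (σ x)) * CharTwo.two_eq_zero (R := K)

end MainForm

section Kernel

open Matrix

variable {F K : Type*} [Field F] [Field K] [Algebra F K]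

/-- The coordinate vector of a triple, to which the cross product of Mathlib applies. -/
def coords (u : K × K × K) : Fin 3 → K := ![u.1, u.2.1, u.2.2]

/-- The linear map `N` with the property that `N (u × w)` is orthogonal to `σ u` whenever
`mainForm σ a b c u w + mainForm σ a b c w u = 0`. -/
def conormal (a b c : K) (v : Fin 3 → K) : Fin 3 → K := ![v 2 + c * v 0, a * v 0, v 1 + b * v 0]

theorem exists_eq_smul_of_cross_eq_zero {u w : K × K × K} (hu : u ≠ 0)
    (h : coords u ⨯₃ coords w = 0) : ∃ t : K, w = t • u := by
  by_contra! hne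
  have hu' : coords u ≠ 0 := fun h0 =>
    hu (Prod.ext (congrFun h0 0) (Prod.ext (congrFun h0 1) (congrFun h0 2)))
  refine crossProduct_ne_zero_iff_linearIndependent.2
    ((LinearIndependent.pair_iff' hu').2 fun t ht => hne t ?_) h
  exact Prod.ext (congrFun ht 0).symm (Prod.ext (congrFun ht 1).symm (congrFun ht 2).symm)

theorem map_cross (σ : K →+* K) (v w : Fin 3 → K) : σ ∘ (v ⨯₃ w) = (σ ∘ v) ⨯₃ (σ ∘ w) := by
  ext i
  fin_cases i <;> simp [cross_apply]

variable [CharP K 2]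

theorem dotProduct_conormal_cross {σ : K →+* K} {a b c : K} {u w : K × K × K}
    (h : mainForm σ a b c u w + mainForm σ a b c w u = 0) :
    (σ ∘ coords u) ⬝ᵥ conormal a b c (coords u ⨯₃ coords w) = 0 := by
  obtain ⟨x, y, z⟩ := u
  obtain ⟨x', y', z'⟩ := w
  simp only [mainForm_apply, Prod.mk_add_mk, Prod.mk_eq_zero] at h
  obtain ⟨h1, h2, h3⟩ := h
  simp only [dotProduct, Fin.sum_univ_three, Function.comp_apply, coords, conormal, cross_apply,
    cons_val]
  linear_combination -y * h1 + z * h2 + (x + b * y) * h3 +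
    ((c * σ x + a * σ y) * (y * z' - z * y') - σ z * (x * z' + b * z * y') -
      σ z' * z * (x + b * y)) * CharTwo.two_eq_zero (R := K)

theorem conormal_cross_map_eq_zero {σ : K →+* K} {a b c : K} {u w : K × K × K}
    (h : mainForm σ a b c u w + mainForm σ a b c w u = 0) :
    conormal a b c (coords u ⨯₃ coords w) ⨯₃ (σ ∘ (coords u ⨯₃ coords w)) = 0 := by
  have hu := dotProduct_conormal_cross h
  have hw := dotProduct_conormal_cross ((add_comm _ _).trans h)
  rw [← cross_anticomm, CharTwo.neg_eq] at hw
  rw [map_cross, cross_cross_eq_smul_sub_smul', hu, dotProduct_comm, hw, zero_smul, zero_smul,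
    sub_zero]

variable [FiniteDimensional F K] [Algebra.IsSeparable F K]

theorem eq_zero_of_conormal_cross_map_eq_zero {σ : K ≃ₐ[F] K} {a b c : K} (ha : a ≠ 0)
    (h : NoTwistedRoot (σ : K →+* K) a b c) {v : Fin 3 → K}
    (hv : conormal a b c v ⨯₃ (σ ∘ v) = 0) : v = 0 := by
  obtain ⟨p, q, r, rfl⟩ : ∃ p q r, v = ![p, q, r] := ⟨v 0, v 1, v 2, by ext i; fin_cases i <;> rfl⟩
  simp only [conormal, cross_apply, Function.comp_apply, cons_val, cons_eq_zero_iff,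
    zero_empty, and_true] at hv
  obtain ⟨h0, h1, h2⟩ := hv
  have hp : p = 0 := by
    by_contra hp
    obtain ⟨e, rfl⟩ : ∃ e, r = e - c * p := ⟨r + c * p, by ring⟩
    rw [sub_add_cancel] at h1 h2
    have he : e ≠ 0 := by
      rintro rfl
      simp [ha, hp] at h2
    have hσe : σ e ≠ 0 := by simpa using he
    have hσσe : σ (σ e) ≠ 0 := by simpa using he
    have h1' : (σ q + σ b * σ p) * σ (σ p) - σ e * (σ (σ e) - σ (σ c) * σ (σ p)) = 0 := by
      simpa using congrArg σ h1
    have hadj : a * (p / e * σ (p / e) * σ (σ (p / e))) + σ b * (σ (p / e) * σ (σ (p / e))) +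
        σ (σ c) * σ (σ (p / e)) + 1 = 0 := by
      simp only [map_div₀]
      field_simp
      linear_combination e * h1' - σ (σ p) * h2 +
        e * σ e * σ (σ e) * CharTwo.two_eq_zero (R := K)
    obtain ⟨x, hx⟩ := exists_twisted_root_of_adjoint_root σ hadj
    exact h x hx
  subst hp
  have hq : q = 0 := by simpa using h0
  have hr : r = 0 := by simpa [hq] using h1
  simp [hq, hr]

theorem mainForm_add_swap_eq_zero_iff {σ : K ≃ₐ[F] K} {a b c : K} (ha : a ≠ 0)
    (h : NoTwistedRoot (σ : K →+* K) a b c) {u w : K × K × K} (hu : u ≠ 0) :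
    mainForm (σ : K →+* K) a b c u w + mainForm (σ : K →+* K) a b c w u = 0 ↔
      ∃ t, σ t = t ∧ t • u = w := by
  have hsmul (t : K) : mainForm (σ : K →+* K) a b c u (t • u) +
      mainForm (σ : K →+* K) a b c (t • u) u = (t + σ t) • mainForm (σ : K →+* K) a b c u u := by
    rw [map_smul, LinearMap.map_smulₛₗ, LinearMap.smul_apply, add_smul, RingHom.coe_coe]
  constructor
  · intro huw
    obtain ⟨t, rfl⟩ := exists_eq_smul_of_cross_eq_zero hu
      (eq_zero_of_conormal_cross_map_eq_zero ha h (conormal_cross_map_eq_zero huw))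
    rw [hsmul, smul_eq_zero, or_iff_left fun h0 => hu (eq_zero_of_mainForm_self_eq_zero ha h h0),
      CharTwo.add_eq_zero] at huw
    exact ⟨t, huw.symm, rfl⟩
  · rintro ⟨t, ht, rfl⟩
    rw [hsmul, ht, CharTwo.add_self_eq_zero, zero_smul]

end Kernel

section MainMap

variable {K : Type*} [Field K] [Fintype K] {m k : ℕ} {a b c : K}

theorem differentialUniformity_mainMap [Algebra (ZMod 2) K] (hK : Fintype.card K = 2 ^ m)
    (ha : a ≠ 0) (h : MainCondition (2 ^ k) a b c) :
    differentialUniformity (mainMap (2 ^ k) a b c) = 2 ^ k.gcd m := by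
  have : CharP K 2 := charP_of_injective_algebraMap (algebraMap (ZMod 2) K).injective 2
  let σ : K ≃ₐ[ZMod 2] K := FiniteField.frobeniusAlgEquivOfAlgebraic (ZMod 2) K ^ k
  have hσ (x : K) : σ x = x ^ 2 ^ k := by
    rw [AlgEquiv.coe_pow, FiniteField.coe_frobeniusAlgEquivOfAlgebraic_iterate, ZMod.card]
  have hpolar := polar_mainMap (σ := (σ : K →+* K)) hσ a b c
  refine differentialUniformity_eq_of_ncard_polar (fun u w w' => ?_) fun u hu => ?_
  · simp only [hpolar, map_add, LinearMap.add_apply]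
    abel
  · have hker : {w | QuadraticMap.polar (mainMap (2 ^ k) a b c) u w = 0} =
        (· • u) '' {t : K | t ^ 2 ^ k = t} := by
      ext w
      simp only [Set.mem_ofPred_eq, hpolar, Set.mem_image, ← hσ,
        mainForm_add_swap_eq_zero_iff ha (h.noTwistedRoot hσ) hu]
    rw [hker, Set.ncard_image_of_injective _ (smul_left_injective K hu),
      ncard_pow_pow_eq_self hK two_pos]

theorem mainMap_mem_mainFamily (hK : Fintype.card K = 2 ^ m) (hmk : ¬ m ∣ k) (ha : a ≠ 0)
    (h : MainCondition (2 ^ k) a b c) : mainMap (2 ^ k) a b c ∈ mainFamily m a b c := by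
  have hm : 0 < m := by
    refine Nat.pos_of_ne_zero ?_
    rintro rfl
    exact Fintype.one_lt_card.ne' hK
  have hpow (x : K) : x ^ 2 ^ (k % m) = x ^ 2 ^ k := pow_pow_mod hK k x
  refine ⟨k % m, Nat.pos_of_ne_zero (hmk ∘ Nat.dvd_of_mod_eq_zero), Nat.mod_lt _ hm, ha, ?_, ?_⟩
  · simpa only [MainCondition, pow_add, pow_one, sq (2 ^ _), pow_mul _ (2 ^ _) (2 ^ _), hpow]
      using h
  · funext ⟨x, y, z⟩
    simp only [mainMap, pow_succ, hpow]

end MainMap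

section LiKaleyski

variable {K : Type*} [Field K]

theorem liKaleyskiMap_linearlyEquivalent_mainMap [Algebra (ZMod 2) K] (s : ℕ) :
    LinearlyEquivalent (liKaleyskiMap K s) (mainMap s (1 : K) 1 0) := by
  let swap : (K × K × K) ≃ₗ[ZMod 2] K × K × K :=
    (LinearEquiv.refl _ K).prodCongr (LinearEquiv.prodComm _ K K)
  refine ⟨swap, swap, ?_⟩
  funext ⟨x, y, z⟩
  simp only [swap, liKaleyskiMap, mainMap, Function.comp_apply, LinearEquiv.prodCongr_apply,
    LinearEquiv.refl_apply, LinearEquiv.prodComm_apply, Prod.swap_prod_mk, Prod.mk.injEq]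
  exact ⟨by ring, by ring, by ring⟩

theorem SingleCondition.mainCondition {s : ℕ} (h : SingleCondition K s) :
    MainCondition s (1 : K) 1 0 := by
  intro x hx
  have hx0 : x ≠ 0 := by
    rintro rfl
    simp at hx
  refine h x⁻¹ ?_
  have hs : x ^ s ^ 2 ≠ 0 := pow_ne_zero _ hx0
  have hs1 : x ^ (s + 1) ≠ 0 := pow_ne_zero _ hx0
  rw [add_assoc (s ^ 2), pow_add _ (s ^ 2)] at hx ⊢
  simp only [inv_pow]
  field_simp
  linear_combination hx

end LiKaleyski

end Triprojective

theorem proposition3p2 (K : Type*) [Field K] [Fintype K] [Algebra (ZMod 2) K]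
    (m k : ℕ) (hK : Fintype.card K = 2 ^ m) :
    -- the map is linearly equivalent to the main map with `a = b = 1`, `c = 0`, same exponent
    Triprojective.LinearlyEquivalent (Triprojective.liKaleyskiMap K (2 ^ k))
      (Triprojective.mainMap (2 ^ k) (1 : K) 1 0) ∧
    -- the single condition is implied by the conditions of Li and Kaleyski
    (Triprojective.LiKaleyskiConditions K (2 ^ k) → Triprojective.SingleCondition K (2 ^ k)) ∧
    -- under the single condition alone, the map is equivalent to a member of the main family
    (Triprojective.SingleCondition K (2 ^ k) → ¬ m ∣ k →
      ∃ G ∈ Triprojective.mainFamily m (1 : K) 1 0,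
        Triprojective.LinearlyEquivalent (Triprojective.liKaleyskiMap K (2 ^ k)) G) ∧
    -- under the single condition alone, the differential uniformity is `2 ^ gcd (k, m)`
    (Triprojective.SingleCondition K (2 ^ k) →
      Triprojective.differentialUniformity (Triprojective.liKaleyskiMap K (2 ^ k)) =
        2 ^ Nat.gcd k m) := by
  have hequiv := Triprojective.liKaleyskiMap_linearlyEquivalent_mainMap (K := K) (2 ^ k)
  refine ⟨hequiv, fun h => h.2.1, fun h hmk => ?_, fun h => ?_⟩
  · exact ⟨_, Triprojective.mainMap_mem_mainFamily hK hmk one_ne_zero h.mainCondition, hequiv⟩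
  · rw [hequiv.differentialUniformity_eq]
    exact Triprojective.differentialUniformity_mainMap hK one_ne_zero h.mainCondition
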